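/- For integers $0\le \ell<M$ and $0\le m\le M$ let $$Q_{sb}(\ell,m,M)=1-2^{-(M-\ell-1)}\sum_{j=0}^{M-m-1}\binom{M-\ell-1}{j}$$ be the single-block success probability for $X=[0,1]$. Let $\ell_{sb}^*(m,M)$ be the smallest integer $\ell\in\{0,\dots,M-1\}$ for which $Q_{sb}(\ell,m,M)$ is closest to $1/2$, and let $\ell_{mb}^*(m,M,B)$ be the smallest integer $\ell\in\{0,\dots,M-1\}$ for which $Q_{sb}(\ell,m,M)^B$ is closest to $1-1/e$. Define the finite-$N$ phase transitions $$\varepsilon^*_{sb}(m,M)=\frac{\ell^*_{sb}(m,M)}{M},\qquad \varepsilon^*_{mb}(m,M,B)=\frac{B\,\ell^*_{mb}(m,M,B)}{B\,M},$$ and let $\varepsilon^*_{asy}(\delta)=(2\delta-1)_+$ and $\gamma_M=\sqrt{2\log M/M}$. Consider a sequence of problem sizes $(m,M,B)$ with $B=M$, $M\to\infty$ and $m/M\to\delta\in(1/2,1)$. Then: 1. With $n=Bm$ and $N=BM$, $n\sim\delta N$. 2. $\varepsilon^*_{sb}(m,M)=\varepsilon^*_{asy}(m/M)+O(1/M)$.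 3. $\varepsilon^*_{mb}(m,M,B)=\varepsilon^*_{asy}(m/M)-\sqrt{2(1-\delta)}\,\gamma_M+o(\gamma_M)$. 4. If $m/M=\delta+O(1/M)$, then $\varepsilon^*_{sb}(m,M)=\varepsilon^*_{asy}(\delta)+O(1/M)$. 5. If $m/M=\delta+o(\gamma_M)$, then $\varepsilon^*_{mb}(m,M,B)=\varepsilon^*_{asy}(\delta)-\sqrt{2(1-\delta)}\,\gamma_M+o(\gamma_M)$. 6. $\varepsilon^*_{sb}(m,M)\to\varepsilon^*_{asy}(\delta)$ and $\varepsilon^*_{mb}(m,M,B)\to\varepsilon^*_{asy}(\delta)$. 7. $\varepsilon^*_{sb}(m,M)-\varepsilon^*_{mb}(m,M,B)\sim\sqrt{2(1-\delta)}\,\gamma_M$. -/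

import Mathlib

open Filter Topology Asymptotics

namespace MultiBlock

noncomputable section

/-- The binomial quantity `P_{k,n} = 2^{-(n-1)} ∑_{j=0}^{k-1} (n-1 choose j)` (for `n ≥ 1`). -/
def binomialTail (k n : ℕ) : ℝ :=
  (∑ j ∈ Finset.range k, ((n - 1).choose j : ℝ)) / 2 ^ (n - 1)

/-- The single-block success probability for coefficients in `[0,1]`,
`Q_sb(ℓ, m, M) = 1 - P_{M-m, M-ℓ}`, for `m ≤ M` and `ℓ < M`. -/
def Qsb (ℓ m M : ℕ) : ℝ :=
  1 - binomialTail (M - m) (M - ℓ)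

/-- The success probability of a problem made of `B` independent blocks. -/
def Qmb (ℓ m M B : ℕ) : ℝ :=
  Qsb ℓ m M ^ B

/-- The smallest integer `ℓ ∈ {0, …, M-1}` whose success probability `Q ℓ` is closest to `q`. -/
def criticalCount (Q : ℕ → ℝ) (q : ℝ) (M : ℕ) : ℕ :=
  sInf {ℓ : ℕ | ℓ < M ∧ ∀ j < M, |Q ℓ - q| ≤ |Q j - q|}

/-- The reference success level of the single-block problem. -/
def qStarSb : ℝ := 1 / 2

/-- The reference success level of the multi-block problem. -/
def qStarMb : ℝ := 1 - 1 / Real.exp 1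

/-- The single-block finite-size phase transition location. -/
def epsSb (m M : ℕ) : ℝ :=
  (criticalCount (fun ℓ => Qsb ℓ m M) qStarSb M : ℝ) / M

/-- The multi-block finite-size phase transition location `k* / N`, with `k* = B ℓ*`, `N = B M`. -/
def epsMb (m M B : ℕ) : ℝ :=
  ((B : ℝ) * (criticalCount (fun ℓ => Qmb ℓ m M B) qStarMb M : ℝ)) / ((B : ℝ) * (M : ℝ))

/-- The asymptotic phase transition `(2δ - 1)_+`. -/
def epsAsy (δ : ℝ) : ℝ :=
  max (2 * δ - 1) 0

/-- `γ_M = √(2 log M / M)`. -/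
def gam (M : ℕ) : ℝ :=
  Real.sqrt (2 * Real.log M / M)

end

end MultiBlock

/-!
Write `P = 1 - Qsb ℓ m M`, the probability that a symmetric binomial variable with `M - ℓ - 1`
trials is less than `M - m`. It increases with `ℓ` and, by symmetry, equals `1 / 2` exactly at
`ℓ = 2 m - M` (if `M ≤ 2 m < 2 M`; it is at least `1 / 2` throughout if `2 m < M`), so the
single-block transition coincides with the asymptotic one.

For `B` blocks, `(1 - P) ^ B` crosses `1 - 1 / e` where `B P` is of order one: Bernoulli's
inequality and `1 - P ≤ exp (-P)` confine the crossing to `1 / e ≤ B P ≤ 1`. At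
`ℓ = 2 m - M - c √(2 M log M)` the variable has to fall short of its mean by a moderate deviation,
and `P = M ^ (-c² / (2 (1 - δ)) + o(1))`. If `B = M ^ (β + o(1))`, the exponents balance at
`c = √(2 β (1 - δ))`.
-/

namespace MultiBlock

lemma sum_range_choose_succ_add_choose (n k : ℕ) :
    ∑ j ∈ Finset.range (k + 1), (n + 1).choose j + n.choose k =
      2 * ∑ j ∈ Finset.range (k + 1), n.choose j := by
  induction k with
  | zero => simp
  | succ k ih =>
    rw [Finset.sum_range_succ, Finset.sum_range_succ _ (k + 1), Nat.choose_succ_succ]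
    lia

lemma binomialTail_add_two (k n : ℕ) :
    binomialTail (k + 1) (n + 2) =
      binomialTail (k + 1) (n + 1) - (n.choose k : ℝ) / 2 ^ (n + 1) := by
  have h : (∑ j ∈ Finset.range (k + 1), ((n + 1).choose j : ℝ)) + n.choose k =
      2 * ∑ j ∈ Finset.range (k + 1), (n.choose j : ℝ) := by
    exact_mod_cast sum_range_choose_succ_add_choose n k
  rw [eq_sub_iff_add_eq, binomialTail, binomialTail, Nat.add_sub_cancel,
    show n + 2 - 1 = n + 1 from rfl, ← add_div, h, pow_succ]
  field_simp

lemma binomialTail_antitone (k : ℕ) : Antitone (binomialTail k) := by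
  refine antitone_nat_of_succ_le fun n => ?_
  rcases k with _ | k
  · simp [binomialTail]
  rcases n with _ | n
  · simp [binomialTail]
  rw [binomialTail_add_two]
  exact sub_le_self _ (by positivity)

lemma binomialTail_strictAntiOn {k : ℕ} (hk : 0 < k) :
    StrictAntiOn (binomialTail k) (Set.Ici k) := by
  intro n hn n' _ hnn'
  obtain ⟨k, rfl⟩ := Nat.exists_eq_add_one_of_ne_zero hk.ne'
  obtain ⟨n, rfl⟩ := Nat.exists_eq_add_of_le' (Nat.le_of_add_left_le hn : 1 ≤ n)
  have hchoose : 0 < n.choose k := Nat.choose_pos (Nat.le_of_add_le_add_right hn)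
  calc binomialTail (k + 1) n' ≤ binomialTail (k + 1) (n + 2) := binomialTail_antitone _ hnn'
    _ = binomialTail (k + 1) (n + 1) - n.choose k / 2 ^ (n + 1) := binomialTail_add_two k n
    _ < binomialTail (k + 1) (n + 1) := sub_lt_self _ (by positivity)

lemma binomialTail_pos {k : ℕ} (hk : 0 < k) (n : ℕ) : 0 < binomialTail k n := by
  refine div_pos (Finset.sum_pos' (fun _ _ => by positivity) ⟨0, ?_⟩) (by positivity)
  simpa using hk

lemma binomialTail_le_one (k n : ℕ) : binomialTail k n ≤ 1 := by
  calc binomialTail k n ≤ binomialTail k 0 := binomialTail_antitone k n.zero_le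
    _ ≤ 1 := by
      rcases k with _ | k <;> simp [binomialTail, Finset.sum_range_succ']

lemma binomialTail_two_mul_self {k : ℕ} (hk : 0 < k) : binomialTail k (2 * k) = 1 / 2 := by
  obtain ⟨k, rfl⟩ := Nat.exists_eq_add_one_of_ne_zero hk.ne'
  have h : (∑ j ∈ Finset.range (k + 1), ((2 * k + 1).choose j : ℝ)) = 4 ^ k := by
    exact_mod_cast Nat.sum_range_choose_halfway k
  rw [binomialTail, show 2 * (k + 1) - 1 = 2 * k + 1 by lia, h, pow_succ, pow_mul]
  norm_num
  field_simp

lemma sum_range_choose_mul_exp (n : ℕ) (u : ℝ) :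
    ∑ j ∈ Finset.range (n + 1), (n.choose j : ℝ) * Real.exp (u * (n - 2 * j)) =
      (2 * Real.cosh u) ^ n := by
  rw [Real.cosh_eq, mul_div_cancel₀ _ two_ne_zero, add_comm (Real.exp u), add_pow]
  refine Finset.sum_congr rfl fun j hj => ?_
  rw [← Real.exp_nat_mul, ← Real.exp_nat_mul, ← Real.exp_add, mul_comm,
    Nat.cast_sub (Finset.mem_range_succ_iff.1 hj)]
  ring_nf

lemma sum_range_choose_le_exp_mul_cosh_pow {k n : ℕ} (hk : k ≤ n + 1) {u : ℝ} (hu : 0 ≤ u) :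
    ∑ j ∈ Finset.range k, (n.choose j : ℝ) ≤
      Real.exp (-(u * (n - 2 * k))) * (2 * Real.cosh u) ^ n := by
  rw [← sum_range_choose_mul_exp, Finset.mul_sum]
  calc ∑ j ∈ Finset.range k, (n.choose j : ℝ)
      ≤ ∑ j ∈ Finset.range k, Real.exp (-(u * (n - 2 * k))) *
          (n.choose j * Real.exp (u * (n - 2 * j))) := by
        refine Finset.sum_le_sum fun j hj => ?_
        have hjk : (j : ℝ) ≤ k := by exact_mod_cast (Finset.mem_range.1 hj).le
        rw [mul_left_comm, ← Real.exp_add]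
        refine le_mul_of_one_le_right (by positivity) (Real.one_le_exp ?_)
        nlinarith
    _ ≤ _ := Finset.sum_le_sum_of_subset_of_nonneg (Finset.range_mono hk)
        fun _ _ _ => by positivity

lemma binomialTail_le_exp {k n : ℕ} (hn : 0 < n) (h : 2 * k ≤ n) :
    binomialTail k (n + 1) ≤ Real.exp (-(((n : ℝ) - 2 * k) ^ 2 / (2 * n))) := by
  -- The optimal tilt of the exponential Markov inequality.
  set u : ℝ := ((n : ℝ) - 2 * k) / n with hu
  have hu0 : 0 ≤ u := div_nonneg (sub_nonneg.2 (by exact_mod_cast h)) n.cast_nonneg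
  rw [binomialTail, Nat.add_sub_cancel, div_le_iff₀ (by positivity)]
  calc ∑ j ∈ Finset.range k, (n.choose j : ℝ)
      ≤ Real.exp (-(u * (n - 2 * k))) * (2 * Real.cosh u) ^ n :=
        sum_range_choose_le_exp_mul_cosh_pow (by lia) hu0
    _ ≤ Real.exp (-(u * (n - 2 * k))) * (2 * Real.exp (u ^ 2 / 2)) ^ n := by
        gcongr
        exact Real.cosh_le_exp_half_sq u
    _ = Real.exp (-(u * (n - 2 * k)) + n * (u ^ 2 / 2)) * 2 ^ n := by
        rw [mul_pow, ← Real.exp_nat_mul, Real.exp_add]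
        ring
    _ = _ := by
        congr 2
        rw [hu]
        field_simp
        ring

lemma sixteen_pow_le_centralBinom_sq_mul {h : ℕ} (hh : 0 < h) :
    16 ^ h ≤ h.centralBinom ^ 2 * (4 * h) := by
  induction h, hh using Nat.le_induction with
  | base => norm_num [Nat.centralBinom]
  | succ h _ ih =>
    refine Nat.le_of_mul_le_mul_left ?_ h.add_one_pos
    calc (h + 1) * 16 ^ (h + 1) = 16 * (h + 1) * 16 ^ h := by ring
      _ ≤ 16 * (h + 1) * (h.centralBinom ^ 2 * (4 * h)) := by gcongr
      _ = 16 * h.centralBinom ^ 2 * (4 * h * (h + 1)) := by ring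
      _ ≤ 16 * h.centralBinom ^ 2 * (2 * h + 1) ^ 2 := by gcongr; lia
      _ = 4 * (2 * (2 * h + 1) * h.centralBinom) ^ 2 := by ring
      _ = 4 * ((h + 1) * (h + 1).centralBinom) ^ 2 := by rw [Nat.succ_mul_centralBinom_succ]
      _ = (h + 1) * ((h + 1).centralBinom ^ 2 * (4 * (h + 1))) := by ring

lemma four_pow_le_two_mul_sqrt_mul_centralBinom {h : ℕ} (hh : 0 < h) :
    (4 : ℝ) ^ h ≤ 2 * √h * h.centralBinom := by
  have hsq : (16 : ℝ) ^ h ≤ h.centralBinom ^ 2 * (4 * h) := by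
    exact_mod_cast sixteen_pow_le_centralBinom_sq_mul hh
  refine le_of_sq_le_sq ?_ (by positivity)
  calc ((4 : ℝ) ^ h) ^ 2 = 16 ^ h := by rw [← pow_mul, mul_comm, pow_mul]; norm_num
    _ ≤ h.centralBinom ^ 2 * (4 * h) := hsq
    _ = (2 * √h * h.centralBinom) ^ 2 := by
      rw [mul_pow, mul_pow, Real.sq_sqrt h.cast_nonneg]
      ring

lemma centralBinom_mul_exp_le_choose {h y : ℕ} (hy : y < h) :
    (h.centralBinom : ℝ) * Real.exp (-((y : ℝ) ^ 2 / (h - y))) ≤ (2 * h).choose (h - y) := by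
  induction y with
  | zero => simp [Nat.centralBinom]
  | succ y ih =>
    have hyh : (y : ℝ) + 1 < h := by exact_mod_cast hy
    have hratio : ((2 * h).choose (h - y) : ℝ) * ((h - y) / (h + y + 1)) =
        (2 * h).choose (h - (y + 1)) := by
      have hrec := Nat.choose_succ_right_eq (2 * h) (h - (y + 1))
      rw [show h - (y + 1) + 1 = h - y by lia, show 2 * h - (h - (y + 1)) = h + y + 1 by lia]
        at hrec
      rw [← Nat.cast_sub (by lia), ← mul_div_assoc, div_eq_iff (by positivity)]
      exact_mod_cast hrec
    have hstep : Real.exp (-((2 * y + 1) / (h - y))) ≤ ((h : ℝ) - y) / (h + y + 1) := by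
      rw [Real.exp_neg, inv_le_comm₀ (Real.exp_pos _) (div_pos (by linarith) (by linarith)),
        inv_div]
      calc ((h : ℝ) + y + 1) / (h - y) = (2 * y + 1) / (h - y) + 1 := by
            rw [div_add_one (by linarith)]
            ring
        _ ≤ _ := Real.add_one_le_exp _
    have hexponent : (y : ℝ) ^ 2 / (h - y) + (2 * y + 1) / (h - y) ≤
        ((y + 1 : ℕ) : ℝ) ^ 2 / (h - (y + 1 : ℕ)) := by
      rw [← add_div, show (y : ℝ) ^ 2 + (2 * y + 1) = (y + 1) ^ 2 by ring]
      push_cast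
      gcongr
      linarith
    calc (h.centralBinom : ℝ) * Real.exp (-(((y + 1 : ℕ) : ℝ) ^ 2 / (h - (y + 1 : ℕ))))
        ≤ h.centralBinom * Real.exp (-((y : ℝ) ^ 2 / (h - y) + (2 * y + 1) / (h - y))) := by
          gcongr
      _ = h.centralBinom * Real.exp (-((y : ℝ) ^ 2 / (h - y))) *
            Real.exp (-((2 * y + 1) / (h - y))) := by
          rw [neg_add, Real.exp_add, mul_assoc]
      _ ≤ (2 * h).choose (h - y) * (((h : ℝ) - y) / (h + y + 1)) := by
          gcongr
          exact ih (by lia)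
      _ = (2 * h).choose (h - (y + 1)) := hratio

lemma mul_centralBinom_mul_exp_le_sum_choose {k w : ℕ} (hw : w < k) (x : ℕ) :
    w * ((k + x).centralBinom * Real.exp (-(((x : ℝ) + w) ^ 2 / (k - w)))) ≤
      ∑ j ∈ Finset.range k, ((2 * (k + x)).choose j : ℝ) := by
  set E := Real.exp (-(((x : ℝ) + w) ^ 2 / (k - w)))
  have hterm : ∀ i ∈ Finset.range w,
      (k + x).centralBinom * E ≤ (2 * (k + x)).choose (k - 1 - i) := by
    intro i hi
    have hiw : i < w := Finset.mem_range.1 hi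
    have hiw' : (i : ℝ) + 1 ≤ w := by exact_mod_cast hiw
    have hwk : (w : ℝ) < k := by exact_mod_cast hw
    have h := centralBinom_mul_exp_le_choose (h := k + x) (y := x + 1 + i) (by lia)
    rw [show k + x - (x + 1 + i) = k - 1 - i by lia] at h
    refine le_trans ?_ h
    push_cast
    gcongr ?_ * Real.exp (-(?_ ^ 2 / ?_)) <;> linarith
  rw [← Finset.sum_range_reflect]
  calc w * ((k + x).centralBinom * E)
      = ∑ _i ∈ Finset.range w, ((k + x).centralBinom * E) := by simp
    _ ≤ ∑ i ∈ Finset.range w, ((2 * (k + x)).choose (k - 1 - i) : ℝ) := Finset.sum_le_sum hterm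
    _ ≤ _ := Finset.sum_le_sum_of_subset_of_nonneg (Finset.range_mono hw.le)
        fun _ _ _ => by positivity

/-- The `w ≥ √(k + x)` largest summands of the tail make up for the factor `√(k + x)` by which
`Nat.centralBinom (k + x)` falls short of `4 ^ (k + x)`, so that no power of `k` is lost. -/
lemma exp_div_two_le_binomialTail {k x w : ℕ} (hw : w < k) (hwk : k + x ≤ w ^ 2) :
    Real.exp (-(((x : ℝ) + w) ^ 2 / (k - w))) / 2 ≤ binomialTail k (2 * (k + x) + 1) := by
  set E := Real.exp (-(((x : ℝ) + w) ^ 2 / (k - w)))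
  have hsqrt : √((k + x : ℕ) : ℝ) ≤ w := Real.sqrt_le_iff.2 ⟨w.cast_nonneg, by exact_mod_cast hwk⟩
  rw [binomialTail, Nat.add_sub_cancel, le_div_iff₀ (by positivity), pow_mul]
  calc E / 2 * (2 ^ 2) ^ (k + x) = E / 2 * 4 ^ (k + x) := by norm_num
    _ ≤ E / 2 * (2 * √((k + x : ℕ) : ℝ) * (k + x).centralBinom) := by
      gcongr
      exact four_pow_le_two_mul_sqrt_mul_centralBinom (by lia)
    _ = √((k + x : ℕ) : ℝ) * ((k + x).centralBinom * E) := by ring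
    _ ≤ w * ((k + x).centralBinom * E) := by gcongr
    _ ≤ _ := mul_centralBinom_mul_exp_le_sum_choose hw x

lemma log_binomialTail_le {k : ℕ} (hk : 0 < k) (x : ℕ) :
    Real.log (binomialTail k (2 * (k + x) + 1)) ≤ -((x : ℝ) ^ 2 / (k + x)) := by
  have htail := Real.log_le_log (binomialTail_pos hk _)
    (binomialTail_le_exp (k := k) (n := 2 * (k + x)) (by lia) (by lia))
  rw [Real.log_exp] at htail
  refine htail.trans_eq ?_
  push_cast
  field_simp
  ring

lemma le_log_binomialTail {k x w : ℕ} (hw : w < k) (hwk : k + x ≤ w ^ 2) :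
    -(((x : ℝ) + w) ^ 2 / (k - w)) - Real.log 2 ≤
      Real.log (binomialTail k (2 * (k + x) + 1)) := by
  have htail := Real.log_le_log (by positivity) (exp_div_two_le_binomialTail hw hwk)
  rwa [Real.log_div (Real.exp_ne_zero _) two_ne_zero, Real.log_exp] at htail

lemma Qsb_nonneg (ℓ m M : ℕ) : 0 ≤ Qsb ℓ m M :=
  sub_nonneg.2 (binomialTail_le_one _ _)

lemma Qsb_antitone (m M : ℕ) : Antitone fun ℓ => Qsb ℓ m M := fun _ _ h =>
  sub_le_sub_left (binomialTail_antitone _ (Nat.sub_le_sub_left h M)) 1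

lemma Qsb_strictAntiOn {m M : ℕ} (hm : m < M) :
    StrictAntiOn (fun ℓ => Qsb ℓ m M) (Set.Iic m) := fun _ hℓ _ hℓ' h =>
  sub_lt_sub_left (binomialTail_strictAntiOn (Nat.sub_pos_of_lt hm)
    (Nat.sub_le_sub_left hℓ' M) (Nat.sub_le_sub_left hℓ M)
    (Nat.sub_lt_sub_left (hℓ'.trans_lt hm |>.trans_le' h.le) h)) 1

lemma Qmb_antitone (m M B : ℕ) : Antitone fun ℓ => Qmb ℓ m M B := fun _ _ h =>
  pow_le_pow_left₀ (Qsb_nonneg _ _ _) (Qsb_antitone m M h) B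

lemma Qmb_strictAntiOn {m M B : ℕ} (hm : m < M) (hB : B ≠ 0) :
    StrictAntiOn (fun ℓ => Qmb ℓ m M B) (Set.Iic m) := fun _ hℓ _ hℓ' h =>
  pow_lt_pow_left₀ (Qsb_strictAntiOn hm hℓ hℓ' h) (Qsb_nonneg _ _ _) hB

lemma criticalCount_mem {M : ℕ} (hM : 0 < M) (Q : ℕ → ℝ) (q : ℝ) :
    criticalCount Q q M ∈ {ℓ : ℕ | ℓ < M ∧ ∀ j < M, |Q ℓ - q| ≤ |Q j - q|} := by
  refine Nat.sInf_mem ?_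
  obtain ⟨ℓ, hℓ, hmin⟩ := Finset.exists_min_image (Finset.range M) (fun ℓ => |Q ℓ - q|)
    ⟨0, Finset.mem_range.2 hM⟩
  exact ⟨ℓ, Finset.mem_range.1 hℓ, fun j hj => hmin j (Finset.mem_range.2 hj)⟩

lemma le_criticalCount {M ℓ : ℕ} {Q : ℕ → ℝ} {q : ℝ} (hℓ : ℓ < M) (hq : q ≤ Q ℓ)
    (hQ : StrictAntiOn Q (Set.Iic ℓ)) : ℓ ≤ criticalCount Q q M := by
  by_contra! hlt
  have hmin := (criticalCount_mem (ℓ.zero_le.trans_lt hℓ) Q q).2 ℓ hℓ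
  have hQlt : Q ℓ < Q (criticalCount Q q M) := hQ hlt.le Set.self_mem_Iic hlt
  rw [abs_of_nonneg (by linarith), abs_of_nonneg (by linarith)] at hmin
  linarith

lemma criticalCount_le {M ℓ : ℕ} {Q : ℕ → ℝ} {q : ℝ} (hℓ : ℓ < M) (hq : Q ℓ ≤ q)
    (hQ : AntitoneOn Q (Set.Ico ℓ M)) : criticalCount Q q M ≤ ℓ := by
  by_contra! hlt
  obtain ⟨hcM, hmin⟩ := criticalCount_mem (ℓ.zero_le.trans_lt hℓ) Q q
  have hQle : Q (criticalCount Q q M) ≤ Q ℓ := hQ ⟨le_rfl, hℓ⟩ ⟨hlt.le, hcM⟩ hlt.le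
  refine hlt.not_ge (Nat.sInf_le ⟨hℓ, fun j hj => le_trans ?_ (hmin j hj)⟩)
  rw [abs_of_nonpos (by linarith), abs_of_nonpos (by linarith)]
  linarith

lemma criticalCount_Qsb {m M : ℕ} (hm : m < M) :
    criticalCount (fun ℓ => Qsb ℓ m M) qStarSb M = 2 * m - M := by
  have hk : 0 < M - m := Nat.sub_pos_of_lt hm
  refine le_antisymm (criticalCount_le (by lia) ?_ ((Qsb_antitone m M).antitoneOn _)) ?_
  · have htail : 1 / 2 ≤ binomialTail (M - m) (M - (2 * m - M)) :=
      (binomialTail_two_mul_self hk).symm.trans_le (binomialTail_antitone _ (by lia))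
    rw [Qsb, qStarSb]
    linarith
  · rcases le_total M (2 * m) with h | h
    · refine le_criticalCount (by lia) ?_
        ((Qsb_strictAntiOn hm).mono (Set.Iic_subset_Iic.2 (by lia)))
      rw [Qsb, show M - (2 * m - M) = 2 * (M - m) by lia, binomialTail_two_mul_self hk, qStarSb]
      norm_num
    · simp [Nat.sub_eq_zero_of_le h]

theorem epsSb_eq_epsAsy {m M : ℕ} (hm : m < M) : epsSb m M = epsAsy (m / M) := by
  have hM : (0 : ℝ) < M := by exact_mod_cast m.zero_le.trans_lt hm
  have hcast : ((2 * m - M : ℕ) : ℤ) = max (2 * (m : ℤ) - M) 0 := by lia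
  calc epsSb m M = max (2 * (m : ℝ) - M) 0 / M := by
        rw [epsSb, criticalCount_Qsb hm]
        congr 1
        exact_mod_cast hcast
    _ = max ((2 * (m : ℝ) - M) / M) (0 / M) := (max_div_div_right hM.le _ _).symm
    _ = epsAsy (m / M) := by rw [epsAsy, zero_div, sub_div, div_self hM.ne', mul_div_assoc]

lemma le_criticalCount_Qmb {m M B ℓ : ℕ} (hm : m < M) (hB : B ≠ 0) (hℓ : ℓ ≤ m)
    (h : B * binomialTail (M - m) (M - ℓ) ≤ Real.exp (-1)) :
    ℓ ≤ criticalCount (fun ℓ => Qmb ℓ m M B) qStarMb M := by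
  refine le_criticalCount (hℓ.trans_lt hm) ?_
    ((Qmb_strictAntiOn hm hB).mono (Set.Iic_subset_Iic.2 hℓ))
  have htail := binomialTail_le_one (M - m) (M - ℓ)
  calc qStarMb = 1 - Real.exp (-1) := by rw [qStarMb, one_div, Real.exp_neg]
    _ ≤ 1 + B * -binomialTail (M - m) (M - ℓ) := by linarith
    _ ≤ (1 + -binomialTail (M - m) (M - ℓ)) ^ B := one_add_mul_le_pow (by linarith) B
    _ = Qmb ℓ m M B := by rw [Qmb, Qsb, sub_eq_add_neg]

lemma exp_neg_one_le_qStarMb : Real.exp (-1) ≤ qStarMb := by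
  have h : Real.exp (-1) ≤ 1 / 2 := by
    rw [Real.exp_neg, one_div]
    exact inv_anti₀ two_pos (by linarith [Real.exp_one_gt_d9])
  rw [qStarMb, one_div, ← Real.exp_neg]
  linarith

lemma criticalCount_Qmb_le {m M B ℓ : ℕ} (hℓ : ℓ < M)
    (h : 1 ≤ B * binomialTail (M - m) (M - ℓ)) :
    criticalCount (fun ℓ => Qmb ℓ m M B) qStarMb M ≤ ℓ := by
  refine criticalCount_le hℓ ?_ ((Qmb_antitone m M B).antitoneOn _)
  calc Qmb ℓ m M B ≤ Real.exp (-binomialTail (M - m) (M - ℓ)) ^ B :=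
        pow_le_pow_left₀ (Qsb_nonneg _ _ _) (Real.one_sub_le_exp_neg _) B
    _ = Real.exp (-(B * binomialTail (M - m) (M - ℓ))) := by rw [← Real.exp_nat_mul, mul_neg]
    _ ≤ Real.exp (-1) := by gcongr
    _ ≤ qStarMb := exp_neg_one_le_qStarMb

/-- The moderate deviation scale `√(2 M log M) = M γ_M` on which the multi-block transition is
shifted. -/
noncomputable def devScale (M : ℕ) : ℝ :=
  √(2 * M * Real.log M)

lemma devScale_nonneg (M : ℕ) : 0 ≤ devScale M := Real.sqrt_nonneg _

lemma sq_devScale (M : ℕ) : devScale M ^ 2 = 2 * M * Real.log M :=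
  Real.sq_sqrt (mul_nonneg (by positivity) (Real.log_natCast_nonneg M))

lemma gam_eq_devScale_div (M : ℕ) : gam M = devScale M / M := by
  rcases Nat.eq_zero_or_pos M with rfl | hM
  · simp [gam]
  have h : 2 * M * Real.log M = 2 * Real.log M / M * (M : ℝ) ^ 2 := by field_simp
  rw [gam, devScale, h, Real.sqrt_mul' _ (by positivity), Real.sqrt_sq M.cast_nonneg,
    mul_div_cancel_right₀ _ (by positivity)]

lemma devScale_eq_sqrt_mul (M : ℕ) : devScale M = √M * √(2 * Real.log M) := by
  rw [devScale, ← Real.sqrt_mul M.cast_nonneg]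
  ring_nf

lemma tendsto_log_natCast : Tendsto (fun M : ℕ => Real.log M) atTop atTop :=
  Real.tendsto_log_atTop.comp tendsto_natCast_atTop_atTop

lemma tendsto_sqrt_two_mul_log : Tendsto (fun M : ℕ => √(2 * Real.log M)) atTop atTop :=
  Real.tendsto_sqrt_atTop.comp (tendsto_log_natCast.const_mul_atTop two_pos)

lemma tendsto_devScale : Tendsto devScale atTop atTop := by
  rw [funext devScale_eq_sqrt_mul]
  exact (Real.tendsto_sqrt_atTop.comp tendsto_natCast_atTop_atTop).atTop_mul_atTop₀
    tendsto_sqrt_two_mul_log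

lemma tendsto_sqrt_div_devScale : Tendsto (fun M : ℕ => √M / devScale M) atTop (𝓝 0) := by
  refine tendsto_sqrt_two_mul_log.inv_tendsto_atTop.congr' ?_
  filter_upwards [eventually_ge_atTop 1] with M hM
  rw [devScale_eq_sqrt_mul, div_mul_cancel_left₀ (by positivity), Pi.inv_apply]

lemma tendsto_gam : Tendsto gam atTop (𝓝 0) := by
  have h : Tendsto (fun x : ℝ => Real.log x / x) atTop (𝓝 0) :=
    Real.isLittleO_log_id_atTop.tendsto_div_nhds_zero
  have hsqrt := ((h.comp tendsto_natCast_atTop_atTop).const_mul 2).sqrt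
  rw [mul_zero, Real.sqrt_zero] at hsqrt
  exact hsqrt.congr fun M => by rw [gam, mul_div_assoc, Function.comp_apply]

section Asymptotics

variable {ι : Type*} {l : Filter ι} {M : ι → ℕ}

lemma tendsto_div_of_tendsto_div_devScale {y : ι → ℝ} {a : ℝ} (hM : Tendsto M l atTop)
    (hy : Tendsto (fun i => y i / devScale (M i)) l (𝓝 a)) :
    Tendsto (fun i => y i / M i) l (𝓝 0) := by
  have h := hy.mul (tendsto_gam.comp hM)
  rw [mul_zero] at h
  refine h.congr' ?_
  filter_upwards [(tendsto_devScale.comp hM).eventually_gt_atTop 0] with i hi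
  rw [Function.comp_apply] at hi ⊢
  rw [gam_eq_devScale_div, div_mul_div_cancel₀ hi.ne']

lemma tendsto_sq_div_div_log {y h : ι → ℝ} {a κ : ℝ} (hκ : κ ≠ 0) (hM : Tendsto M l atTop)
    (hy : Tendsto (fun i => y i / devScale (M i)) l (𝓝 a))
    (hh : Tendsto (fun i => h i / M i) l (𝓝 κ)) :
    Tendsto (fun i => y i ^ 2 / h i / Real.log (M i)) l (𝓝 (2 * a ^ 2 / κ)) := by
  refine (((hy.pow 2).const_mul 2).div hh hκ).congr' ?_
  filter_upwards [hM.eventually_gt_atTop 1] with i hi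
  have hlog : 0 < Real.log (M i) := Real.log_pos (by exact_mod_cast hi)
  rw [Pi.div_apply, div_pow, sq_devScale]
  field_simp

lemma tendsto_natSqrt_div_devScale {h : ι → ℕ} {κ : ℝ} (hM : Tendsto M l atTop)
    (hh : Tendsto (fun i => (h i : ℝ) / M i) l (𝓝 κ)) :
    Tendsto (fun i => (Nat.sqrt (h i) : ℝ) / devScale (M i)) l (𝓝 0) := by
  have hlim : Tendsto (fun i => √((h i : ℝ) / M i) * (√(M i) / devScale (M i))) l (𝓝 0) := by
    simpa [Function.comp_def] using hh.sqrt.mul (tendsto_sqrt_div_devScale.comp hM)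
  refine squeeze_zero' (.of_forall fun i => div_nonneg (Nat.cast_nonneg _) (devScale_nonneg _))
    ?_ hlim
  filter_upwards [hM.eventually_gt_atTop 0] with i hi
  have hsqrt : √((h i : ℝ) / M i) * √(M i) = √(h i) := by
    rw [← Real.sqrt_mul (by positivity), div_mul_cancel₀ _ (by positivity)]
  rw [← mul_div_assoc, hsqrt]
  exact div_le_div_of_nonneg_right Real.nat_sqrt_le_real_sqrt (devScale_nonneg _)

theorem tendsto_log_binomialTail_div_log {k x : ι → ℕ} {κ a : ℝ} (hκ : 0 < κ)
    (hM : Tendsto M l atTop) (hk : Tendsto (fun i => (k i : ℝ) / M i) l (𝓝 κ))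
    (hx : Tendsto (fun i => (x i : ℝ) / devScale (M i)) l (𝓝 a)) :
    Tendsto (fun i => Real.log (binomialTail (k i) (2 * (k i + x i) + 1)) / Real.log (M i)) l
      (𝓝 (-(2 * a ^ 2 / κ))) := by
  set w : ι → ℕ := fun i => Nat.sqrt (k i + x i) + 1
  have hkx : Tendsto (fun i => ((k i : ℝ) + x i) / M i) l (𝓝 κ) := by
    simpa only [add_div, add_zero] using hk.add (tendsto_div_of_tendsto_div_devScale hM hx)
  have hw : Tendsto (fun i => (w i : ℝ) / devScale (M i)) l (𝓝 0) := by
    have hone := (tendsto_devScale.comp hM).inv_tendsto_atTop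
    have hsqrt := tendsto_natSqrt_div_devScale (h := fun i => k i + x i) hM (by exact_mod_cast hkx)
    simpa [w, add_div, Function.comp_def] using hsqrt.add hone
  have hxw : Tendsto (fun i => ((x i : ℝ) + w i) / devScale (M i)) l (𝓝 a) := by
    simpa only [add_div, add_zero] using hx.add hw
  have hkw : Tendsto (fun i => ((k i : ℝ) - w i) / M i) l (𝓝 κ) := by
    simpa only [sub_div, sub_zero] using hk.sub (tendsto_div_of_tendsto_div_devScale hM hw)
  have hlower := ((tendsto_sq_div_div_log hκ.ne' hM hxw hkw).neg).sub
    ((tendsto_log_natCast.comp hM).const_div_atTop (Real.log 2))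
  rw [sub_zero] at hlower
  have hpos : ∀ᶠ i in l, w i < k i := by
    filter_upwards [hkw.eventually_const_lt hκ, hM.eventually_gt_atTop 0] with i hi hMi
    have hwk : (0 : ℝ) < k i - w i := (div_pos_iff_of_pos_right (by exact_mod_cast hMi)).1 hi
    exact_mod_cast sub_pos.1 hwk
  refine tendsto_of_tendsto_of_tendsto_of_le_of_le' hlower
    (tendsto_sq_div_div_log hκ.ne' hM hx hkx).neg ?_ ?_
  · filter_upwards [hpos] with i hi
    rw [Function.comp_apply, ← neg_div, ← sub_div]
    exact div_le_div_of_nonneg_right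
      (le_log_binomialTail hi (by rw [sq]; exact (Nat.lt_succ_sqrt _).le))
      (Real.log_natCast_nonneg _)
  · filter_upwards [hpos] with i hi
    rw [← neg_div]
    exact div_le_div_of_nonneg_right (log_binomialTail_le (by lia) _) (Real.log_natCast_nonneg _)

/-- The count lying `c √(2 M log M)` below the single-block transition `2 m - M`, rounded so that
the number `M - ℓ - 1` of trials in `Qsb ℓ m M` is even. -/
noncomputable def shiftedCount (c : ℝ) (m M : ℕ) : ℕ :=
  M - (2 * (M - m + ⌊c / 2 * devScale M⌋₊) + 1)

variable {m B : ι → ℕ} {β δ c : ℝ}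

lemma eventually_lt_of_tendsto_div (hδ : δ < 1) (hM : Tendsto M l atTop)
    (hm : Tendsto (fun i => (m i : ℝ) / M i) l (𝓝 δ)) : ∀ᶠ i in l, m i < M i := by
  filter_upwards [hm.eventually_lt_const hδ, hM.eventually_gt_atTop 0] with i hi hMi
  exact_mod_cast (div_lt_one (by exact_mod_cast hMi)).1 hi

lemma tendsto_natCast_sub_div (hδ : δ < 1) (hM : Tendsto M l atTop)
    (hm : Tendsto (fun i => (m i : ℝ) / M i) l (𝓝 δ)) :
    Tendsto (fun i => ((M i - m i : ℕ) : ℝ) / M i) l (𝓝 (1 - δ)) := by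
  refine (hm.const_sub 1).congr' ?_
  filter_upwards [eventually_lt_of_tendsto_div hδ hM hm] with i hi
  have hMi : (M i : ℝ) ≠ 0 := by exact_mod_cast hi.ne_bot
  rw [Nat.cast_sub hi.le, sub_div, div_self hMi]

lemma tendsto_natFloor_mul_devScale_div (hc : 0 ≤ c) (hM : Tendsto M l atTop) :
    Tendsto (fun i => (⌊c / 2 * devScale (M i)⌋₊ : ℝ) / devScale (M i)) l (𝓝 (c / 2)) :=
  (tendsto_nat_floor_mul_div_atTop (by positivity)).comp (tendsto_devScale.comp hM)

lemma eventually_sub_shiftedCount (hδ : δ ∈ Set.Ioo (1 / 2 : ℝ) 1) (hc : 0 ≤ c)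
    (hM : Tendsto M l atTop) (hm : Tendsto (fun i => (m i : ℝ) / M i) l (𝓝 δ)) :
    ∀ᶠ i in l, M i - shiftedCount c (m i) (M i) =
      2 * (M i - m i + ⌊c / 2 * devScale (M i)⌋₊) + 1 := by
  have hsum := ((tendsto_natCast_sub_div hδ.2 hM hm).add (tendsto_div_of_tendsto_div_devScale hM
    (tendsto_natFloor_mul_devScale_div hc hM))).const_mul 2 |>.add
    (tendsto_inv_atTop_nhds_zero_nat.comp hM)
  filter_upwards [hsum.eventually_lt_const (show 2 * (1 - δ + 0) + 0 < 1 by linarith [hδ.1]),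
    hM.eventually_gt_atTop 0] with i hi hMi
  have hle : 2 * (M i - m i + ⌊c / 2 * devScale (M i)⌋₊) + 1 < M i := by
    rw [Function.comp_apply, ← add_div, ← mul_div_assoc, ← one_div, ← add_div,
      div_lt_one (by exact_mod_cast hMi)] at hi
    exact_mod_cast hi
  exact Nat.sub_sub_self hle.le

lemma tendsto_sub_shiftedCount_div (hδ : δ ∈ Set.Ioo (1 / 2 : ℝ) 1) (hc : 0 ≤ c)
    (hM : Tendsto M l atTop) (hm : Tendsto (fun i => (m i : ℝ) / M i) l (𝓝 δ)) :
    Tendsto (fun i => (2 * (m i : ℝ) - M i - shiftedCount c (m i) (M i)) / devScale (M i)) l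
      (𝓝 c) := by
  have hlim := ((tendsto_natFloor_mul_devScale_div hc hM).const_mul 2).add
    (tendsto_devScale.comp hM).inv_tendsto_atTop
  rw [mul_div_cancel₀ _ two_ne_zero, add_zero] at hlim
  refine hlim.congr' ?_
  filter_upwards [eventually_sub_shiftedCount hδ hc hM hm,
    eventually_lt_of_tendsto_div hδ.2 hM hm] with i hi hlt
  have hle : shiftedCount c (m i) (M i) ≤ M i := Nat.sub_le _ _
  have hcast : (M i : ℝ) - shiftedCount c (m i) (M i) =
      2 * (M i - m i + ⌊c / 2 * devScale (M i)⌋₊) + 1 := by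
    rw [← Nat.cast_sub hle, hi, ← Nat.cast_sub hlt.le]
    push_cast
    rfl
  rw [Pi.inv_apply, Function.comp_apply, ← mul_div_assoc, ← one_div, ← add_div]
  congr 1
  linarith

lemma tendsto_log_mul_binomialTail_div_log (hδ : δ ∈ Set.Ioo (1 / 2 : ℝ) 1) (hc : 0 ≤ c)
    (hM : Tendsto M l atTop) (hm : Tendsto (fun i => (m i : ℝ) / M i) l (𝓝 δ))
    (hB : Tendsto (fun i => Real.log (B i) / Real.log (M i)) l (𝓝 β)) (hB0 : ∀ᶠ i in l, B i ≠ 0) :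
    Tendsto (fun i => Real.log (B i * binomialTail (M i - m i)
      (M i - shiftedCount c (m i) (M i))) / Real.log (M i)) l
      (𝓝 (β - c ^ 2 / (2 * (1 - δ)))) := by
  have htail := tendsto_log_binomialTail_div_log (sub_pos.2 hδ.2) hM
    (tendsto_natCast_sub_div hδ.2 hM hm) (tendsto_natFloor_mul_devScale_div hc hM)
  have hrate : β + -(2 * (c / 2) ^ 2 / (1 - δ)) = β - c ^ 2 / (2 * (1 - δ)) := by
    field_simp [(sub_pos.2 hδ.2).ne']
    ring
  refine hrate ▸ (hB.add htail).congr' ?_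
  filter_upwards [eventually_sub_shiftedCount hδ hc hM hm, hB0,
    eventually_lt_of_tendsto_div hδ.2 hM hm] with i hi hBi hlt
  have hpos := binomialTail_pos (Nat.sub_pos_of_lt hlt) (M i - shiftedCount c (m i) (M i))
  rw [Real.log_mul (by exact_mod_cast hBi) hpos.ne', hi, add_div]

lemma eventually_ne_zero_of_tendsto_log_div_log (hβ : 0 < β)
    (hB : Tendsto (fun i => Real.log (B i) / Real.log (M i)) l (𝓝 β)) : ∀ᶠ i in l, B i ≠ 0 := by
  filter_upwards [hB.eventually_const_lt hβ] with i hi h0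
  simp [h0] at hi

lemma eventually_shiftedCount_le_criticalCount (hδ : δ ∈ Set.Ioo (1 / 2 : ℝ) 1) (hβ : 0 < β)
    (hM : Tendsto M l atTop) (hm : Tendsto (fun i => (m i : ℝ) / M i) l (𝓝 δ))
    (hB : Tendsto (fun i => Real.log (B i) / Real.log (M i)) l (𝓝 β))
    (hc : √(2 * β * (1 - δ)) < c) :
    ∀ᶠ i in l, shiftedCount c (m i) (M i) ≤
      criticalCount (fun ℓ => Qmb ℓ (m i) (M i) (B i)) qStarMb (M i) := by
  have hδ1 : 0 < 2 * (1 - δ) := by linarith [hδ.2]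
  have hc0 : 0 < c := (Real.sqrt_nonneg _).trans_lt hc
  have hB0 := eventually_ne_zero_of_tendsto_log_div_log hβ hB
  have hrate : β - c ^ 2 / (2 * (1 - δ)) < 0 := by
    rw [sub_neg, lt_div_iff₀ hδ1]
    linarith [(Real.sqrt_lt' hc0).1 hc]
  have hlog := (tendsto_log_mul_binomialTail_div_log hδ hc0.le hM hm hB hB0).neg_mul_atTop hrate
    (tendsto_log_natCast.comp hM)
  filter_upwards [hlog.eventually_le_atBot (-1), hB0, eventually_lt_of_tendsto_div hδ.2 hM hm,
    hM.eventually_gt_atTop 1] with i hi hBi hlt hMi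
  rw [Function.comp_apply, div_mul_cancel₀ _ (Real.log_pos (by exact_mod_cast hMi)).ne'] at hi
  exact le_criticalCount_Qmb hlt hBi (by rw [shiftedCount]; lia)
    ((Real.le_exp_log _).trans (Real.exp_le_exp.2 hi))

lemma eventually_criticalCount_le_shiftedCount (hδ : δ ∈ Set.Ioo (1 / 2 : ℝ) 1) (hβ : 0 < β)
    (hM : Tendsto M l atTop) (hm : Tendsto (fun i => (m i : ℝ) / M i) l (𝓝 δ))
    (hB : Tendsto (fun i => Real.log (B i) / Real.log (M i)) l (𝓝 β))
    (hc0 : 0 ≤ c) (hc : c < √(2 * β * (1 - δ))) :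
    ∀ᶠ i in l, criticalCount (fun ℓ => Qmb ℓ (m i) (M i) (B i)) qStarMb (M i) ≤
      shiftedCount c (m i) (M i) := by
  have hδ1 : 0 < 2 * (1 - δ) := by linarith [hδ.2]
  have hrate : 0 < β - c ^ 2 / (2 * (1 - δ)) := by
    rw [sub_pos, div_lt_iff₀ hδ1]
    linarith [(Real.lt_sqrt hc0).1 hc]
  have hlog := tendsto_log_mul_binomialTail_div_log hδ hc0 hM hm hB
    (eventually_ne_zero_of_tendsto_log_div_log hβ hB)
  filter_upwards [hlog.eventually_const_lt hrate, hM.eventually_gt_atTop 1] with i hi hMi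
  have htail : 0 ≤ binomialTail (M i - m i) (M i - shiftedCount c (m i) (M i)) :=
    div_nonneg (by positivity) (by positivity)
  refine criticalCount_Qmb_le (by rw [shiftedCount]; lia)
    ((Real.log_pos_iff (by positivity)).1 ?_).le
  exact (div_pos_iff_of_pos_right (Real.log_pos (by exact_mod_cast hMi))).1 hi

/-- The critical shift is where the tail rate `c ^ 2 / (2 * (1 - δ))` balances the exponent `β` of
the number of blocks. -/
theorem tendsto_sub_criticalCount_Qmb_div (hδ : δ ∈ Set.Ioo (1 / 2 : ℝ) 1) (hβ : 0 < β)
    (hM : Tendsto M l atTop) (hm : Tendsto (fun i => (m i : ℝ) / M i) l (𝓝 δ))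
    (hB : Tendsto (fun i => Real.log (B i) / Real.log (M i)) l (𝓝 β)) :
    Tendsto (fun i => (2 * (m i : ℝ) - M i -
      criticalCount (fun ℓ => Qmb ℓ (m i) (M i) (B i)) qStarMb (M i)) / devScale (M i)) l
      (𝓝 √(2 * β * (1 - δ))) := by
  have hs : 0 < √(2 * β * (1 - δ)) := by
    have := sub_pos.2 hδ.2
    positivity
  refine tendsto_order.2 ⟨fun a ha => ?_, fun b hb => ?_⟩
  · obtain ⟨c, hac, hc⟩ := exists_between (max_lt ha hs)
    obtain ⟨hac, hc0⟩ := max_lt_iff.1 hac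
    filter_upwards [eventually_criticalCount_le_shiftedCount hδ hβ hM hm hB hc0.le hc,
      (tendsto_sub_shiftedCount_div hδ hc0.le hM hm).eventually_const_lt hac] with i hle hlt
    refine hlt.trans_le (div_le_div_of_nonneg_right ?_ (devScale_nonneg _))
    gcongr
  · obtain ⟨c, hc, hcb⟩ := exists_between hb
    filter_upwards [eventually_shiftedCount_le_criticalCount hδ hβ hM hm hB hc,
      (tendsto_sub_shiftedCount_div hδ (hs.trans hc).le hM hm).eventually_lt_const hcb]
      with i hle hlt
    refine (div_le_div_of_nonneg_right ?_ (devScale_nonneg _)).trans_lt hlt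
    gcongr

lemma lipschitzWith_epsAsy : LipschitzWith 2 epsAsy := by
  refine LipschitzWith.max_const (.of_dist_le_mul fun a b => ?_) 0
  rw [Real.dist_eq, Real.dist_eq, sub_sub_sub_cancel_right, ← mul_sub, abs_mul]
  norm_num

lemma tendsto_epsAsy_div (hm : Tendsto (fun i => (m i : ℝ) / M i) l (𝓝 δ)) :
    Tendsto (fun i => epsAsy (m i / M i)) l (𝓝 (epsAsy δ)) :=
  (lipschitzWith_epsAsy.continuous.tendsto δ).comp hm

lemma epsAsy_div_sub_isBigO (m M : ι → ℕ) (δ : ℝ) :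
    (fun i => epsAsy (m i / M i) - epsAsy δ) =O[l] fun i => (m i : ℝ) / M i - δ :=
  .of_bound 2 (.of_forall fun _ => lipschitzWith_epsAsy.dist_le_mul _ _)

lemma eventually_epsSb_eq_epsAsy (hδ : δ < 1) (hM : Tendsto M l atTop)
    (hm : Tendsto (fun i => (m i : ℝ) / M i) l (𝓝 δ)) :
    (fun i => epsSb (m i) (M i)) =ᶠ[l] fun i => epsAsy (m i / M i) :=
  (eventually_lt_of_tendsto_div hδ hM hm).mono fun _ => epsSb_eq_epsAsy

theorem epsMb_sub_isLittleO_gam (hδ : δ ∈ Set.Ioo (1 / 2 : ℝ) 1) (hβ : 0 < β)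
    (hM : Tendsto M l atTop) (hm : Tendsto (fun i => (m i : ℝ) / M i) l (𝓝 δ))
    (hB : Tendsto (fun i => Real.log (B i) / Real.log (M i)) l (𝓝 β)) :
    (fun i => epsMb (m i) (M i) (B i) -
        (epsAsy (m i / M i) - √(2 * β * (1 - δ)) * gam (M i)))
      =o[l] fun i => gam (M i) := by
  have hlim := (tendsto_sub_criticalCount_Qmb_div hδ hβ hM hm hB).const_sub √(2 * β * (1 - δ))
  rw [sub_self] at hlim
  refine isLittleO_iff_exists_eq_mul.2 ⟨_, hlim, ?_⟩
  filter_upwards [hm.eventually_const_lt hδ.1, hM.eventually_gt_atTop 0,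
    eventually_ne_zero_of_tendsto_log_div_log hβ hB,
    (tendsto_devScale.comp hM).eventually_gt_atTop 0] with i hδi hMi hBi hTi
  have hBi' : (B i : ℝ) ≠ 0 := by exact_mod_cast hBi
  have hTi' : devScale (M i) ≠ 0 := hTi.ne'
  rw [Pi.mul_apply, gam_eq_devScale_div, epsMb, mul_div_mul_left _ _ hBi', epsAsy,
    max_eq_left (by linarith)]
  field_simp
  ring

lemma natCast_mul_isEquivalent (hδ : δ ≠ 0) (hm : Tendsto (fun i => (m i : ℝ) / M i) l (𝓝 δ))
    (B : ι → ℕ) : (fun i => (B i : ℝ) * m i) ~[l] fun i => δ * ((B i : ℝ) * M i) := by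
  have h : (fun i => (m i : ℝ)) ~[l] fun i => δ * (M i : ℝ) := by
    refine isEquivalent_of_tendsto_one ?_
    have hlim := hm.div_const δ
    rw [div_self hδ] at hlim
    exact hlim.congr fun i => by rw [Pi.div_apply, div_div, mul_comm δ]
  exact ((IsEquivalent.refl (u := fun i => (B i : ℝ))).mul h).congr_right
    (.of_forall fun i => mul_left_comm _ _ _)

lemma epsSb_sub_epsMb_isEquivalent (hδ : δ ∈ Set.Ioo (1 / 2 : ℝ) 1) (hβ : 0 < β)
    (hM : Tendsto M l atTop) (hm : Tendsto (fun i => (m i : ℝ) / M i) l (𝓝 δ))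
    (hB : Tendsto (fun i => Real.log (B i) / Real.log (M i)) l (𝓝 β)) :
    (fun i => epsSb (m i) (M i) - epsMb (m i) (M i) (B i)) ~[l]
      fun i => √(2 * β * (1 - δ)) * gam (M i) := by
  have hs : √(2 * β * (1 - δ)) ≠ 0 := by
    have := sub_pos.2 hδ.2
    positivity
  refine ((epsMb_sub_isLittleO_gam hδ hβ hM hm hB).neg_left.const_mul_right hs).congr' ?_ .rfl
  filter_upwards [eventually_epsSb_eq_epsAsy hδ.2 hM hm] with i hi
  rw [Pi.sub_apply, hi]
  ring

lemma tendsto_epsMb (hδ : δ ∈ Set.Ioo (1 / 2 : ℝ) 1) (hβ : 0 < β)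
    (hM : Tendsto M l atTop) (hm : Tendsto (fun i => (m i : ℝ) / M i) l (𝓝 δ))
    (hB : Tendsto (fun i => Real.log (B i) / Real.log (M i)) l (𝓝 β)) :
    Tendsto (fun i => epsMb (m i) (M i) (B i)) l (𝓝 (epsAsy δ)) := by
  have hgam := tendsto_gam.comp hM
  simpa using ((epsMb_sub_isLittleO_gam hδ hβ hM hm hB).trans_tendsto hgam).add
    ((tendsto_epsAsy_div hm).sub (hgam.const_mul √(2 * β * (1 - δ))))

lemma tendsto_log_div_log_self (hM : Tendsto M l atTop) :
    Tendsto (fun i => Real.log (M i) / Real.log (M i)) l (𝓝 1) :=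
  tendsto_const_nhds.congr' <| ((tendsto_log_natCast.comp hM).eventually_ne_atTop 0).mono
    fun _ hi => (div_self hi).symm

end Asymptotics

end MultiBlock

theorem lemma2p5_general {ι : Type*} {l : Filter ι} {δ β : ℝ} (hδ : δ ∈ Set.Ioo (1 / 2 : ℝ) 1)
    (hβ : 0 < β) {m M B : ι → ℕ} (hM : Tendsto M l atTop)
    (hB : Tendsto (fun i => Real.log (B i) / Real.log (M i)) l (𝓝 β))
    (hm : Tendsto (fun i => (m i : ℝ) / (M i : ℝ)) l (𝓝 δ)) :
    ((fun i => (B i : ℝ) * (m i : ℝ)) ~[l] fun i => δ * ((B i : ℝ) * (M i : ℝ))) ∧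
    ((fun i => MultiBlock.epsSb (m i) (M i) - MultiBlock.epsAsy ((m i : ℝ) / (M i : ℝ)))
      =O[l] fun i => 1 / (M i : ℝ)) ∧
    ((fun i => MultiBlock.epsMb (m i) (M i) (B i) -
        (MultiBlock.epsAsy ((m i : ℝ) / (M i : ℝ)) -
          √(2 * β * (1 - δ)) * MultiBlock.gam (M i)))
      =o[l] fun i => MultiBlock.gam (M i)) ∧
    (((fun i => (m i : ℝ) / (M i : ℝ) - δ) =O[l] fun i => 1 / (M i : ℝ)) →
      (fun i => MultiBlock.epsSb (m i) (M i) - MultiBlock.epsAsy δ)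
        =O[l] fun i => 1 / (M i : ℝ)) ∧
    (((fun i => (m i : ℝ) / (M i : ℝ) - δ) =o[l] fun i => MultiBlock.gam (M i)) →
      (fun i => MultiBlock.epsMb (m i) (M i) (B i) -
          (MultiBlock.epsAsy δ - √(2 * β * (1 - δ)) * MultiBlock.gam (M i)))
        =o[l] fun i => MultiBlock.gam (M i)) ∧
    Tendsto (fun i => MultiBlock.epsSb (m i) (M i)) l (𝓝 (MultiBlock.epsAsy δ)) ∧
    Tendsto (fun i => MultiBlock.epsMb (m i) (M i) (B i)) l (𝓝 (MultiBlock.epsAsy δ)) ∧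
    ((fun i => MultiBlock.epsSb (m i) (M i) - MultiBlock.epsMb (m i) (M i) (B i))
      ~[l] fun i => √(2 * β * (1 - δ)) * MultiBlock.gam (M i)) := by
  have hSb := MultiBlock.eventually_epsSb_eq_epsAsy hδ.2 hM hm
  have hMb := MultiBlock.epsMb_sub_isLittleO_gam hδ hβ hM hm hB
  have hAsy := MultiBlock.epsAsy_div_sub_isBigO (l := l) m M δ
  refine ⟨MultiBlock.natCast_mul_isEquivalent (by linarith [hδ.1]) hm B, ?_, hMb, fun h => ?_,
    fun h => ?_, (MultiBlock.tendsto_epsAsy_div hm).congr' hSb.symm,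
    MultiBlock.tendsto_epsMb hδ hβ hM hm hB,
    MultiBlock.epsSb_sub_epsMb_isEquivalent hδ hβ hM hm hB⟩
  · exact (isBigO_zero _ _).congr' (hSb.mono fun i hi => (sub_eq_zero.2 hi).symm) .rfl
  · exact (hAsy.trans h).congr' (hSb.symm.sub .rfl) .rfl
  · exact (hMb.add (hAsy.trans_isLittleO h)).congr_left fun i => by ring

theorem lemma2p5 (δ : ℝ) (hδ : δ ∈ Set.Ioo (1 / 2 : ℝ) 1) (m M B : ℕ → ℕ)
    (hB : ∀ i, B i = M i) (hM : Tendsto M atTop atTop)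
    (hm : Tendsto (fun i => (m i : ℝ) / (M i : ℝ)) atTop (𝓝 δ)) :
    -- `n ∼ δ N`
    ((fun i => (B i : ℝ) * (m i : ℝ)) ~[atTop] fun i => δ * ((B i : ℝ) * (M i : ℝ))) ∧
    -- expansions around the asymptotic transition at the actual ratio `m / M`
    ((fun i => MultiBlock.epsSb (m i) (M i) - MultiBlock.epsAsy ((m i : ℝ) / (M i : ℝ)))
      =O[atTop] fun i => 1 / (M i : ℝ)) ∧
    ((fun i => MultiBlock.epsMb (m i) (M i) (B i) -
        (MultiBlock.epsAsy ((m i : ℝ) / (M i : ℝ)) -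
          Real.sqrt (2 * (1 - δ)) * MultiBlock.gam (M i)))
      =o[atTop] fun i => MultiBlock.gam (M i)) ∧
    -- expansions around the asymptotic transition at the limiting ratio `δ`
    (((fun i => (m i : ℝ) / (M i : ℝ) - δ) =O[atTop] fun i => 1 / (M i : ℝ)) →
      (fun i => MultiBlock.epsSb (m i) (M i) - MultiBlock.epsAsy δ)
        =O[atTop] fun i => 1 / (M i : ℝ)) ∧
    (((fun i => (m i : ℝ) / (M i : ℝ) - δ) =o[atTop] fun i => MultiBlock.gam (M i)) →
      (fun i => MultiBlock.epsMb (m i) (M i) (B i) -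
          (MultiBlock.epsAsy δ - Real.sqrt (2 * (1 - δ)) * MultiBlock.gam (M i)))
        =o[atTop] fun i => MultiBlock.gam (M i)) ∧
    -- both transitions converge to the asymptotic one
    Tendsto (fun i => MultiBlock.epsSb (m i) (M i)) atTop (𝓝 (MultiBlock.epsAsy δ)) ∧
    Tendsto (fun i => MultiBlock.epsMb (m i) (M i) (B i)) atTop (𝓝 (MultiBlock.epsAsy δ)) ∧
    -- the offset of the multi-block transition below the single-block one
    ((fun i => MultiBlock.epsSb (m i) (M i) - MultiBlock.epsMb (m i) (M i) (B i))
      ~[atTop] fun i => Real.sqrt (2 * (1 - δ)) * MultiBlock.gam (M i)) := by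
  obtain rfl : B = M := funext hB
  simpa only [mul_one] using
    lemma2p5_general hδ one_pos hM (MultiBlock.tendsto_log_div_log_self hM) hm
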